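/- Let $f(z)=\sum_{k\ge 0}a_kz^k\in\mathbb{Z}[[z]]$ be a power series with integer coefficients, with radius of convergence $R_f>0$ and with infinitely many non-zero coefficients. Assume that $f$ is a generalized Liouville series, that is, there exist integers $0\le t_0\le s_1<t_1\le s_2<t_2\le s_3<\cdots$ such that $a_k=0$ for $k<t_0$ and for $s_n<k<t_n$ ($n=1,2,\ldots$), such that $t_n/s_n\to\infty$ as $n\to\infty$, and such that the quotients $s_{n+1}/t_n$ ($n\ge 1$) are bounded. Assume also that $f$ is of bounded type, that is, there exists $A>0$ with $|a_k|\le A$ for all $k$ (so that $R_f=1$). Let $m$ be a positive integer. Then $f(\alpha)\in U_m$ for all but finitely many simple algebraic integers $\alpha\in\mathbb{C}$ of degree $m$ satisfying $|\alpha|<R_f$. Here an algebraic number $\alpha$ is called simple if the only subfields of $\mathbb{Q}(\alpha)$ are $\mathbb{Q}$ and $\mathbb{Q}(\alpha)$. The set $U_m$ consists of the transcendental complex numbers $\gamma$ for which $m$ is the smallest positive integer with the following property: for every $w>0$ there exist infinitely many algebraic numbers $\beta\in\mathbb{C}$ of degree $m$ satisfying $|\gamma-\beta|<|\mathrm{M}_\beta|^{-w}$,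 where $\mathrm{M}_\beta\in\mathbb{Z}[T]$ is the minimal polynomial of $\beta$ over $\mathbb{Z}$ (irreducible in $\mathbb{Z}[T]$ and vanishing at $\beta$, unique up to sign), and $|\mathrm{M}_\beta|$ is the maximum of the absolute values of its coefficients. -/

import Mathlib

open Polynomial Filter

noncomputable section

/-! ### `U_m`-numbers -/

/-- `P` is a minimal polynomial of `β` over `ℤ`: a polynomial irreducible in `ℤ[T]` that vanishes
at `β`. For algebraic `β` it exists and is unique up to sign. -/
def IsIntMinpoly (β : ℂ) (P : ℤ[X]) : Prop :=
  Irreducible P ∧ aeval β P = 0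

/-- The algebraic numbers `β` of degree `k` with `|γ - β| < |M_β| ^ (-w)`, where `|M_β|` is the
maximal absolute value of the coefficients of the minimal polynomial `M_β` of `β`. -/
def goodApproximations (γ : ℂ) (k : ℕ) (w : ℝ) : Set ℂ :=
  {β | IsAlgebraic ℚ β ∧ (minpoly ℚ β).natDegree = k ∧
    ∃ M : ℤ[X], IsIntMinpoly β M ∧ ‖γ - β‖ < M.supNorm ^ (-w)}

/-- The set `U_m`: transcendental `γ` such that `m` is the smallest positive integer `k` for which,
for every `w > 0`, infinitely many algebraic `β` of degree `k` satisfy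
`|γ - β| < |M_β| ^ (-w)`. -/
def UNumbers (m : ℕ) : Set ℂ :=
  {γ | Transcendental ℚ γ ∧
    IsLeast {k : ℕ | 0 < k ∧ ∀ w : ℝ, 0 < w → (goodApproximations γ k w).Infinite} m}

/-! ### Power series with integer coefficients -/

/-- The radius of convergence `R_f` of `f` as a complex power series. -/
def convergenceRadius (f : PowerSeries ℤ) : ENNReal :=
  (FormalMultilinearSeries.ofScalars ℂ (fun k => ((PowerSeries.coeff k f : ℤ) : ℂ))).radius

/-- The value `f(z) = ∑ a_k z ^ k` (meaningful for `|z| < R_f`). -/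
def seriesValue (f : PowerSeries ℤ) (z : ℂ) : ℂ :=
  ∑' k : ℕ, ((PowerSeries.coeff k f : ℤ) : ℂ) * z ^ k

/-- `f` is a generalized Liouville series: it has positive radius of convergence, infinitely many
non-zero coefficients, and there are integers `0 ≤ t₀ ≤ s₁ < t₁ ≤ s₂ < t₂ ≤ …` such that the
coefficients `a_k` vanish for `k < t₀` and for `s_n < k < t_n` (`n ≥ 1`), `t_n / s_n → ∞`, and the
quotients `s_{n+1} / t_n` (`n ≥ 1`) are bounded. The entry `s 0` plays no role. -/
def IsGeneralizedLiouville (f : PowerSeries ℤ) : Prop :=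
  0 < convergenceRadius f ∧
  {k : ℕ | PowerSeries.coeff k f ≠ 0}.Infinite ∧
  ∃ s t : ℕ → ℕ,
    (∀ n, t n ≤ s (n + 1)) ∧
    (∀ n, s (n + 1) < t (n + 1)) ∧
    (∀ k, k < t 0 → PowerSeries.coeff k f = 0) ∧
    (∀ n, 1 ≤ n → ∀ k, s n < k → k < t n → PowerSeries.coeff k f = 0) ∧
    Tendsto (fun n => (t n : ℝ) / (s n : ℝ)) atTop atTop ∧
    ∃ B : ℝ, ∀ n, 1 ≤ n → (s (n + 1) : ℝ) / (t n : ℝ) ≤ B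

/-- `f` is of bounded type: its coefficients are bounded. -/
def IsBoundedType (f : PowerSeries ℤ) : Prop :=
  ∃ A : ℝ, 0 < A ∧ ∀ k, |((PowerSeries.coeff k f : ℤ) : ℝ)| ≤ A

/-! ### Simple algebraic integers -/

/-- `α` is a simple algebraic number: it is algebraic, and `ℚ(α)` has no subfields other than `ℚ`
and `ℚ(α)`. -/
def IsSimpleAlgebraic (α : ℂ) : Prop :=
  IsAlgebraic ℚ α ∧
    ∀ K : IntermediateField ℚ ℂ, K ≤ IntermediateField.adjoin ℚ {α} →
      K = ⊥ ∨ K = IntermediateField.adjoin ℚ {α}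

end

/-!
Let `α` be a simple algebraic integer of degree `m` with `|α| < 1`, and let `β n = g n (α)`, where
`g n` is the truncation of `f` after the exponent `s n`, just before a gap. As the coefficients of
`f` are bounded, `β n` approximates `γ = f(α)` with error `O(ρ ^ t n)` for some `ρ < 1`, while all
conjugates of `β n` are at most `C ^ (s n + 1)`. Since `t n / s n → ∞`, the error is smaller than
any power of the height of `β n`. The structure `RapidApproximation` records this situation.

* The `β n` are not eventually equal to `γ` unless all conjugates of `α` are bounded in terms of the
  coefficients of `f` (`conjugates_le_of_eventually_eq`), which leaves only finitely many `α` of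
  degree `m` (`finite_isIntegral_of_bounded_conjugates`). These are the exceptions of the theorem.
* A nonzero algebraic integer in `ℤ[α]` has norm at least `1` in absolute value, which gives a
  Liouville inequality (`one_le_norm_aeval_mul_pow`) and from it a lower bound for the distance of
  `β n` to other algebraic numbers (`RapidApproximation.exists_separation`). Therefore `γ` is
  transcendental. In particular it is not an integer, so, `α` being simple, `β n` has degree exactly
  `m` for large `n`, and the `β n` are the good approximations of degree `m`.
* Let `ξ` be algebraic of degree `k < m` and large height `H`. As `s (n + 1) / t n` is bounded,
  there is an `n` such that `|γ - β n|` is smaller than a large power of `1 / H` while the conjugates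
  of `β n` are at most a fixed power of `H`. Since `β n` is not a conjugate of `ξ`, the separation
  of `β n` from `ξ` shows that `|γ - ξ|` is at least a fixed power of `1 / H`
  (`RapidApproximation.exists_rpow_neg_le_norm_sub`), so no `k < m` has the defining property of
  `m`.
-/

/-! ### Conjugates, heights and Liouville's inequality -/

/-- The conjugates of `Q(α)`, for `Q ∈ ℤ[X]`, are the values of `Q` at the conjugates of `α`. -/
lemma norm_embedding_le_of_conjugates {α : ℂ} (hα : IsIntegral ℚ α) {Q : ℤ[X]} {D : ℝ}
    (hD : ∀ z ∈ (minpoly ℚ α).rootSet ℂ, ‖aeval z Q‖ ≤ D)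
    (φ : IntermediateField.adjoin ℚ {α} →+* ℂ) :
    ‖φ (aeval (IntermediateField.AdjoinSimple.gen ℚ α) Q)‖ ≤ D := by
  have h : φ (aeval (IntermediateField.AdjoinSimple.gen ℚ α) Q)
      = aeval (φ (IntermediateField.AdjoinSimple.gen ℚ α)) Q := by
    simpa using (aeval_algHom_apply (φ.toIntAlgHom) (IntermediateField.AdjoinSimple.gen ℚ α) Q).symm
  rw [h]
  apply hD
  rw [mem_rootSet]
  refine ⟨minpoly.ne_zero hα, ?_⟩
  have h2 := aeval_algHom_apply (φ.toRatAlgHom) (IntermediateField.AdjoinSimple.gen ℚ α)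
    (minpoly ℚ α)
  have h3 : aeval (IntermediateField.AdjoinSimple.gen ℚ α) (minpoly ℚ α) = 0 := by
    convert! IntermediateField.aeval_gen_minpoly ℚ α
  rw [h3, map_zero] at h2
  simpa using h2

lemma coe_aeval_gen (α : ℂ) (Q : ℤ[X]) :
    ((aeval (IntermediateField.AdjoinSimple.gen ℚ α) Q : IntermediateField.adjoin ℚ {α}) : ℂ)
      = aeval α Q := by
  have h := aeval_algHom_apply
    ((algebraMap (IntermediateField.adjoin ℚ {α}) ℂ).toIntAlgHom)
    (IntermediateField.AdjoinSimple.gen ℚ α) Q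
  simpa using h.symm

lemma isIntegral_aeval_int {α : ℂ} (hα : IsIntegral ℤ α) (Q : ℤ[X]) : IsIntegral ℤ (aeval α Q) := by
  rw [aeval_eq_sum_range]
  exact IsIntegral.sum _ fun i _ => (hα.pow i).smul _

/-- Liouville's inequality: the norm of a nonzero algebraic integer `Q(α)` is a nonzero rational
integer, so `Q(α)` is not small compared with its conjugates. -/
lemma one_le_norm_aeval_mul_pow {α : ℂ} (hα : IsIntegral ℤ α) {Q : ℤ[X]} {D : ℝ} (hD1 : 1 ≤ D)
    (hD : ∀ z ∈ (minpoly ℚ α).rootSet ℂ, ‖aeval z Q‖ ≤ D) (h0 : aeval α Q ≠ 0) :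
    1 ≤ ‖aeval α Q‖ * D ^ (minpoly ℚ α).natDegree := by
  classical
  have hαQ : IsIntegral ℚ α := hα.tower_top
  have : FiniteDimensional ℚ (IntermediateField.adjoin ℚ {α}) :=
    IntermediateField.adjoin.finiteDimensional hαQ
  set x : IntermediateField.adjoin ℚ {α} := aeval (IntermediateField.AdjoinSimple.gen ℚ α) Q with hx
  have hxα : (x : ℂ) = aeval α Q := coe_aeval_gen α Q
  have hx0 : x ≠ 0 := by
    intro h
    apply h0
    rw [← hxα, h]; rfl
  have hxi : IsIntegral ℤ x := by
    have : IsIntegral ℤ (algebraMap (IntermediateField.adjoin ℚ {α}) ℂ x) := by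
      change IsIntegral ℤ (x : ℂ)
      rw [hxα]; exact isIntegral_aeval_int hα Q
    exact (isIntegral_algebraMap_iff (algebraMap (IntermediateField.adjoin ℚ {α}) ℂ).injective).1 this
  have hnorm : 1 ≤ ‖((Algebra.norm ℚ x : ℚ) : ℂ)‖ := by
    have hi := Algebra.isIntegral_norm ℚ hxi
    obtain ⟨b, hb⟩ := IsIntegrallyClosed.isIntegral_iff.1 hi
    have hb0 : b ≠ 0 := by
      rintro rfl
      exact (Algebra.norm_ne_zero_iff.2 hx0) (by rw [← hb]; simp)
    rw [← hb]
    simp only [eq_intCast, Rat.cast_intCast, Complex.norm_intCast]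
    exact_mod_cast Int.one_le_abs hb0
  have hprod := Algebra.norm_eq_prod_embeddings ℚ ℂ x
  rw [eq_ratCast] at hprod
  rw [hprod, norm_prod,
    ← Finset.mul_prod_erase _ _ (Finset.mem_univ
      (algebraMap (IntermediateField.adjoin ℚ {α}) ℂ).toRatAlgHom)] at hnorm
  -- The inclusion of `ℚ(α)` in `ℂ` contributes `Q(α)`, every other embedding at most `D`.
  have hid : (algebraMap (IntermediateField.adjoin ℚ {α}) ℂ).toRatAlgHom x = aeval α Q := hxα
  rw [hid] at hnorm
  refine hnorm.trans (mul_le_mul_of_nonneg_left ?_ (norm_nonneg _))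
  refine (Finset.prod_le_prod (g := fun _ => D) (fun _ _ => norm_nonneg _) ?_).trans ?_
  · intro φ _
    exact norm_embedding_le_of_conjugates hαQ hD (φ : _ →+* ℂ)
  · rw [Finset.prod_const]
    refine pow_le_pow_right₀ hD1 ((Finset.card_erase_le).trans ?_)
    rw [Finset.card_univ, AlgHom.card, IntermediateField.adjoin.finrank hαQ]

/-- The height of `Q(α)` is controlled by the size of its conjugates. -/
lemma supNorm_minpoly_aeval_le {α : ℂ} (hα : IsIntegral ℤ α) {Q : ℤ[X]} {D : ℝ} (hD1 : 1 ≤ D)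
    (hD : ∀ z ∈ (minpoly ℚ α).rootSet ℂ, ‖aeval z Q‖ ≤ D) :
    (minpoly ℤ (aeval α Q)).supNorm ≤ (2 * D) ^ (minpoly ℚ α).natDegree := by
  have hαQ : IsIntegral ℚ α := hα.tower_top
  have : FiniteDimensional ℚ (IntermediateField.adjoin ℚ {α}) :=
    IntermediateField.adjoin.finiteDimensional hαQ
  have : NumberField (IntermediateField.adjoin ℚ {α}) := ⟨⟩
  obtain ⟨i, hi⟩ := (minpoly ℤ (aeval α Q)).exists_eq_supNorm
  have h := NumberField.Embeddings.coeff_bdd_of_norm_le (A := ℂ)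
    (norm_embedding_le_of_conjugates hαQ hD) i
  have hmin : minpoly ℚ (aeval (IntermediateField.AdjoinSimple.gen ℚ α) Q)
      = (minpoly ℤ (aeval α Q)).map (algebraMap ℤ ℚ) := by
    rw [← minpoly.isIntegrallyClosed_eq_field_fractions' ℚ (isIntegral_aeval_int hα Q),
      ← coe_aeval_gen]
    exact (minpoly.algebraMap_eq (algebraMap (IntermediateField.adjoin ℚ {α}) ℂ).injective _).symm
  rw [hmin, coeff_map, eq_intCast, Int.norm_cast_rat, ← hi, max_eq_left hD1,
    IntermediateField.adjoin.finrank hαQ] at h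
  refine h.trans ?_
  rw [mul_pow, mul_comm]
  gcongr
  exact_mod_cast Nat.choose_le_two_pow _ _

/-- There are only finitely many algebraic numbers of bounded degree and height. -/
lemma finite_roots_of_bounded_supNorm (d : ℕ) (H : ℝ) :
    {x : ℂ | ∃ P : ℤ[X], P ≠ 0 ∧ P.natDegree ≤ d ∧ P.supNorm ≤ H ∧ aeval x P = 0}.Finite := by
  classical
  refine (bUnion_roots_finite (algebraMap ℤ ℂ) d
    (Set.finite_Icc (-(⌈H⌉₊ : ℤ)) ⌈H⌉₊)).subset ?_
  rintro x ⟨P, hP0, hPd, hPH, hx⟩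
  simp_rw [Set.mem_iUnion]
  refine ⟨P, ⟨hPd, fun i => ?_⟩, mem_rootSet.2 ⟨hP0, hx⟩⟩
  rw [Set.mem_Icc, ← abs_le, ← @Int.cast_le ℝ]
  have := (P.le_supNorm i).trans (hPH.trans (Nat.le_ceil H))
  rw [Int.norm_eq_abs] at this
  simpa using this

lemma IsIntMinpoly.ne_zero {β : ℂ} {M : ℤ[X]} (h : IsIntMinpoly β M) : M ≠ 0 := h.1.ne_zero

lemma IsIntMinpoly.natDegree_eq {β : ℂ} {M : ℤ[X]} (h : IsIntMinpoly β M) :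
    M.natDegree = (minpoly ℚ β).natDegree := by
  have hdeg : M.natDegree ≠ 0 := by
    intro h0
    rw [natDegree_eq_zero] at h0
    obtain ⟨c, rfl⟩ := h0
    have h2 := h.2
    have h3 := h.ne_zero
    rw [aeval_C, algebraMap_int_eq, eq_intCast, Int.cast_eq_zero] at h2
    exact h3 (by rw [h2, C_0])
  have hirr := (IsPrimitive.Int.irreducible_iff_irreducible_map_cast (h.1.isPrimitive hdeg)).1 h.1
  have hroot : aeval β (M.map (Int.castRingHom ℚ)) = 0 := by
    rw [← algebraMap_int_eq, aeval_map_algebraMap]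
    exact h.2
  rw [← minpoly.eq_of_irreducible hirr hroot, natDegree_mul_C,
    natDegree_map_eq_of_injective Int.cast_injective]
  exact inv_ne_zero (leadingCoeff_ne_zero.2 hirr.ne_zero)

lemma isIntMinpoly_minpoly {β : ℂ} (h : IsIntegral ℤ β) : IsIntMinpoly β (minpoly ℤ β) :=
  ⟨minpoly.irreducible h, minpoly.aeval ℤ β⟩

lemma one_le_supNorm_of_ne_zero {P : ℤ[X]} (h : P ≠ 0) : 1 ≤ P.supNorm := by
  refine le_trans ?_ (P.le_supNorm P.natDegree)
  rw [Int.norm_eq_abs]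
  exact_mod_cast Int.one_le_abs (leadingCoeff_ne_zero.2 h)

/-- In a simple extension, an integral element of `ℤ[α]` is a rational integer or generates
`ℚ(α)`. -/
lemma exists_intCast_eq_or_natDegree_eq {α : ℂ} (hα : IsIntegral ℤ α) (hs : IsSimpleAlgebraic α)
    (Q : ℤ[X]) :
    (∃ b : ℤ, aeval α Q = (b : ℂ)) ∨
      (minpoly ℚ (aeval α Q)).natDegree = (minpoly ℚ α).natDegree := by
  have hαQ : IsIntegral ℚ α := hα.tower_top
  have hβ := isIntegral_aeval_int hα Q
  have hβQ : IsIntegral ℚ (aeval α Q) := hβ.tower_top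
  have hle : IntermediateField.adjoin ℚ {aeval α Q} ≤ IntermediateField.adjoin ℚ {α} := by
    rw [IntermediateField.adjoin_simple_le_iff, ← coe_aeval_gen]
    exact SetLike.coe_mem _
  rcases hs.2 _ hle with h | h
  · left
    rw [IntermediateField.adjoin_simple_eq_bot_iff, IntermediateField.mem_bot] at h
    obtain ⟨q, hq⟩ := h
    rw [← hq] at hβ
    obtain ⟨b, hb⟩ := IsIntegrallyClosed.isIntegral_iff.1
      ((isIntegral_algebraMap_iff (algebraMap ℚ ℂ).injective).1 hβ)
    exact ⟨b, by rw [← hq, ← hb]; simp⟩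
  · right
    rw [← IntermediateField.adjoin.finrank hβQ, ← IntermediateField.adjoin.finrank hαQ, h]

/-! ### Size estimates for integer polynomials -/

/-- There are only finitely many algebraic integers of given degree with bounded conjugates. -/
lemma finite_isIntegral_of_bounded_conjugates (m : ℕ) (B : ℝ) :
    {α : ℂ | IsIntegral ℤ α ∧ (minpoly ℚ α).natDegree = m ∧
      ∀ z ∈ (minpoly ℚ α).rootSet ℂ, ‖z‖ ≤ B}.Finite := by
  refine (finite_roots_of_bounded_supNorm m ((2 * max B 1) ^ m)).subset ?_
  rintro α ⟨hα, hm, hB⟩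
  refine ⟨minpoly ℤ α, minpoly.ne_zero hα, ?_, ?_, minpoly.aeval ℤ α⟩
  · rw [(isIntMinpoly_minpoly hα).natDegree_eq, hm]
  · have := supNorm_minpoly_aeval_le hα (Q := X) (le_max_right B 1)
      (fun z hz => by simpa using Or.inl (hB z hz))
    rwa [aeval_X, hm] at this

lemma norm_root_le_of_coeff_le {Q : ℤ[X]} (hQ : Q ≠ 0) {A : ℝ}
    (hA : ∀ k, |(Q.coeff k : ℝ)| ≤ A) {z : ℂ} (hz : aeval z Q = 0) : ‖z‖ ≤ A + 1 := by
  have hA0 : 0 ≤ A := (abs_nonneg _).trans (hA 0)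
  have hinj : Function.Injective (algebraMap ℤ ℂ) := by
    rw [algebraMap_int_eq]; exact Int.cast_injective
  have hQ' : Q.map (algebraMap ℤ ℂ) ≠ 0 := (Polynomial.map_ne_zero_iff hinj).2 hQ
  have hroot : (Q.map (algebraMap ℤ ℂ)).IsRoot z := by
    rwa [IsRoot.def, eval_map_algebraMap]
  have h := hroot.norm_lt_cauchyBound hQ'
  have h1 : ‖z‖ ≤ (cauchyBound (Q.map (algebraMap ℤ ℂ)) : ℝ) := by exact_mod_cast h.le
  refine h1.trans ?_
  rw [cauchyBound]
  push_cast
  gcongr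
  have hlead : 1 ≤ ‖(Q.map (algebraMap ℤ ℂ)).leadingCoeff‖ := by
    rw [leadingCoeff_map_of_injective hinj]
    simp only [algebraMap_int_eq, eq_intCast, Complex.norm_intCast]
    exact_mod_cast Int.one_le_abs (leadingCoeff_ne_zero.2 hQ)
  refine (div_le_self (by positivity) hlead).trans ?_
  rw [← Real.coe_toNNReal A hA0, NNReal.coe_le_coe]
  refine Finset.sup_le fun k _ => ?_
  rw [← NNReal.coe_le_coe, Real.coe_toNNReal A hA0]
  simpa [Int.norm_eq_abs] using hA k

lemma norm_aeval_le {Q : ℤ[X]} {d : ℕ} (hd : Q.natDegree ≤ d) {H : ℝ}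
    (hH : ∀ k, ‖Q.coeff k‖ ≤ H) {z : ℂ} {R : ℝ} (hR : 1 ≤ R) (hz : ‖z‖ ≤ R) :
    ‖aeval z Q‖ ≤ (d + 1) * H * R ^ d := by
  rw [aeval_eq_sum_range' (Nat.lt_succ_of_le hd)]
  refine (norm_sum_le_of_le _ (f := fun i => Q.coeff i • z ^ i) (n := fun _ => H * R ^ d) ?_).trans
    (by simp [mul_assoc])
  intro i hi
  have hid : i ≤ d := Nat.lt_succ_iff.1 (Finset.mem_range.1 hi)
  have hH0 : 0 ≤ H := (norm_nonneg _).trans (hH 0)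
  rw [zsmul_eq_mul, norm_mul, norm_pow, Complex.norm_intCast, ← Int.norm_eq_abs]
  refine mul_le_mul (hH i) ?_ (by positivity) hH0
  exact (pow_le_pow_left₀ (norm_nonneg _) hz i).trans (pow_le_pow_right₀ hR hid)

lemma norm_pow_sub_pow_le_mul {x y : ℂ} {R : ℝ} (hR : 1 ≤ R) (hx : ‖x‖ ≤ R) (hy : ‖y‖ ≤ R)
    {i d : ℕ} (hid : i ≤ d) : ‖x ^ i - y ^ i‖ ≤ ‖x - y‖ * (d * R ^ d) := by
  rw [← (Commute.all x y).geom_sum₂_mul, norm_mul, mul_comm]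
  refine mul_le_mul_of_nonneg_left ?_ (norm_nonneg _)
  refine (norm_sum_le_of_le _ (n := fun _ => R ^ d) ?_).trans ?_
  · intro j hj
    have hj := Finset.mem_range.1 hj
    rw [norm_mul, norm_pow, norm_pow]
    calc ‖x‖ ^ j * ‖y‖ ^ (i - 1 - j) ≤ R ^ j * R ^ (i - 1 - j) := by gcongr
      _ = R ^ (j + (i - 1 - j)) := (pow_add _ _ _).symm
      _ ≤ R ^ d := pow_le_pow_right₀ hR (by omega)
  · rw [Finset.sum_const, Finset.card_range, nsmul_eq_mul]
    gcongr

lemma norm_aeval_sub_aeval_le {Q : ℤ[X]} {d : ℕ} (hd : Q.natDegree ≤ d) {H : ℝ}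
    (hH : ∀ k, ‖Q.coeff k‖ ≤ H) {x y : ℂ} {R : ℝ} (hR : 1 ≤ R) (hx : ‖x‖ ≤ R) (hy : ‖y‖ ≤ R) :
    ‖aeval x Q - aeval y Q‖ ≤ ‖x - y‖ * ((d + 1) * H * (d * R ^ d)) := by
  rw [aeval_eq_sum_range' (Nat.lt_succ_of_le hd), aeval_eq_sum_range' (Nat.lt_succ_of_le hd),
    ← Finset.sum_sub_distrib]
  refine (norm_sum_le_of_le _ (n := fun _ => H * (‖x - y‖ * (d * R ^ d))) ?_).trans
    (le_of_eq (by simp; ring))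
  intro i hi
  have hid : i ≤ d := Nat.lt_succ_iff.1 (Finset.mem_range.1 hi)
  have hH0 : 0 ≤ H := (norm_nonneg _).trans (hH 0)
  rw [← smul_sub, zsmul_eq_mul, norm_mul, Complex.norm_intCast, ← Int.norm_eq_abs]
  exact mul_le_mul (hH i) (norm_pow_sub_pow_le_mul hR hx hy hid) (norm_nonneg _) hH0

/-! ### Limits -/

lemma eventually_eq_of_tendsto_of_mem_finite {u : ℕ → ℂ} {γ : ℂ} (hu : Tendsto u atTop (nhds γ))
    {F : Set ℂ} (hF : F.Finite) (h : ∀ᶠ n in atTop, u n ∈ F) : ∀ᶠ n in atTop, u n = γ := by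
  have hcl : IsClosed (F \ {γ}) := (hF.subset Set.sdiff_subset).isClosed
  have hmem : (F \ {γ})ᶜ ∈ nhds γ := hcl.isOpen_compl.mem_nhds (by simp)
  filter_upwards [h, hu hmem] with n h1 h2
  by_contra h3
  exact h2 ⟨h1, h3⟩

/-- If `t n / s n → ∞`, then `ρ ^ t n` beats every exponential in `s n`. -/
lemma tendsto_mul_pow_mul_pow_zero {s t : ℕ → ℕ} (hs : Tendsto s atTop atTop)
    (hts : Tendsto (fun n => (t n : ℝ) / (s n : ℝ)) atTop atTop) {ρ : ℝ} (h0 : 0 ≤ ρ) (h1 : ρ < 1)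
    (L C : ℝ) (hC : 0 ≤ C) :
    Tendsto (fun n => L * (C ^ (s n + 1) * ρ ^ t n)) atTop (nhds 0) := by
  -- Once `t n ≥ j * s n`, the product is at most `C * (C * ρ ^ j) ^ s n`.
  obtain ⟨j, hj⟩ : ∃ j : ℕ, C * ρ ^ j ≤ 1 / 2 := by
    have : Tendsto (fun j : ℕ => C * ρ ^ j) atTop (nhds (C * 0)) :=
      (tendsto_pow_atTop_nhds_zero_of_lt_one h0 h1).const_mul C
    rw [mul_zero] at this
    exact (this.eventually_le_const (by norm_num : (0 : ℝ) < 1 / 2)).exists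
  have hlim : Tendsto (fun n => C * (1 / 2 : ℝ) ^ s n) atTop (nhds (C * 0)) :=
    ((tendsto_pow_atTop_nhds_zero_of_lt_one (by norm_num) (by norm_num)).comp hs).const_mul C
  rw [mul_zero] at hlim
  have hmain : Tendsto (fun n => C ^ (s n + 1) * ρ ^ t n) atTop (nhds 0) := by
    refine squeeze_zero' (Eventually.of_forall fun n => by positivity) ?_ hlim
    filter_upwards [hts.eventually_ge_atTop (j : ℝ), hs.eventually_gt_atTop 0] with n hn hsn
    have hsn' : (0 : ℝ) < s n := by exact_mod_cast hsn
    have hjt : j * s n ≤ t n := by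
      rw [le_div_iff₀ hsn'] at hn
      exact_mod_cast hn
    calc C ^ (s n + 1) * ρ ^ t n ≤ C ^ (s n + 1) * ρ ^ (j * s n) :=
          mul_le_mul_of_nonneg_left (pow_le_pow_of_le_one h0 h1.le hjt) (by positivity)
      _ = C * (C * ρ ^ j) ^ s n := by rw [pow_mul, mul_pow]; ring
      _ ≤ C * (1 / 2) ^ s n := by gcongr
  simpa using hmain.const_mul L

/-! ### Numbers rapidly approximated by elements of `ℤ[α]` -/

/-- The numbers `g n (α)`, with `g n ∈ ℤ[X]`, approximate `γ` with error at most `L * ρ ^ t n`,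
while all their conjugates are at most `C ^ (s n + 1)`; here `s n → ∞` and `t n / s n → ∞`, so that
the approximation is better than any power of the height. The values `g n (α)` are not eventually
equal to `γ`. -/
structure RapidApproximation (α γ : ℂ) (g : ℕ → ℤ[X]) (s t : ℕ → ℕ) (C L ρ : ℝ) : Prop where
  isIntegral : IsIntegral ℤ α
  tendsto_s : Tendsto s atTop atTop
  tendsto_div : Tendsto (fun n => (t n : ℝ) / (s n : ℝ)) atTop atTop
  one_le_C : 1 ≤ C
  L_nonneg : 0 ≤ L
  ρ_pos : 0 < ρ
  ρ_lt_one : ρ < 1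
  conjugates_le : ∀ n, ∀ z ∈ (minpoly ℚ α).rootSet ℂ, ‖aeval z (g n)‖ ≤ C ^ (s n + 1)
  error_le : ∀ n, 1 ≤ n → ‖γ - aeval α (g n)‖ ≤ L * ρ ^ t n
  not_eventually_eq : ¬ ∀ᶠ n in atTop, aeval α (g n) = γ

namespace RapidApproximation

variable {α γ : ℂ} {g : ℕ → ℤ[X]} {s t : ℕ → ℕ} {C L ρ : ℝ}

lemma tendsto_error (h : RapidApproximation α γ g s t C L ρ) :
    Tendsto (fun n => L * ρ ^ t n) atTop (nhds 0) := by
  simpa using tendsto_mul_pow_mul_pow_zero h.tendsto_s h.tendsto_div h.ρ_pos.le h.ρ_lt_one L 1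
    zero_le_one

lemma tendsto (h : RapidApproximation α γ g s t C L ρ) :
    Tendsto (fun n => aeval α (g n)) atTop (nhds γ) := by
  rw [tendsto_iff_norm_sub_tendsto_zero]
  refine squeeze_zero' (Eventually.of_forall fun n => norm_nonneg _) ?_ h.tendsto_error
  filter_upwards [eventually_ge_atTop 1] with n hn
  rw [norm_sub_rev]
  exact h.error_le n hn

lemma eventually_norm_le (h : RapidApproximation α γ g s t C L ρ) :
    ∀ᶠ n in atTop, ‖aeval α (g n)‖ ≤ ‖γ‖ + 1 :=
  h.tendsto.norm.eventually_le_const (lt_add_one _)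

/-- A lower bound for the distance of `g n (α)` to an algebraic number `ξ`: by Liouville's
inequality `P (g n (α))` is not small, and `P` is Lipschitz. -/
lemma exists_separation (h : RapidApproximation α γ g s t C L ρ) (d : ℕ) {R : ℝ} (hR : 1 ≤ R) :
    ∃ Λ : ℝ, 0 ≤ Λ ∧ ∃ C₁ : ℝ, 1 ≤ C₁ ∧ ∀ (n : ℕ) (P : ℤ[X]) (ξ : ℂ), P ≠ 0 → P.natDegree ≤ d →
      aeval ξ P = 0 → ‖ξ‖ ≤ R → ‖aeval α (g n)‖ ≤ R → aeval (aeval α (g n)) P ≠ 0 →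
      1 ≤ ‖aeval α (g n) - ξ‖ *
        (Λ * P.supNorm ^ ((minpoly ℚ α).natDegree + 1) * C₁ ^ (s n + 1)) := by
  set m := (minpoly ℚ α).natDegree with hm
  have hC0 : 0 ≤ C := zero_le_one.trans h.one_le_C
  refine ⟨(d + 1) ^ (m + 1) * (d * R ^ d), by positivity, C ^ (d * m),
    one_le_pow₀ h.one_le_C, ?_⟩
  intro n P ξ hP hPd hξ hξR hβR hne
  have hH1 : 1 ≤ P.supNorm := one_le_supNorm_of_ne_zero hP
  have hH := P.le_supNorm
  have hCn : 1 ≤ C ^ (s n + 1) := one_le_pow₀ h.one_le_C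
  have hd1 : (1 : ℝ) ≤ d + 1 := by simp
  have key := one_le_norm_aeval_mul_pow h.isIntegral (Q := P.comp (g n))
    (D := (d + 1) * P.supNorm * (C ^ (s n + 1)) ^ d)
    (one_le_mul_of_one_le_of_one_le (one_le_mul_of_one_le_of_one_le hd1 hH1) (one_le_pow₀ hCn))
    (fun z hz => by
      rw [aeval_comp]
      exact norm_aeval_le hPd hH hCn (h.conjugates_le n z hz))
    (by rwa [aeval_comp])
  rw [aeval_comp, ← hm] at key
  have hlip := norm_aeval_sub_aeval_le hPd hH hR hβR hξR
  rw [hξ, sub_zero] at hlip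
  refine key.trans ((mul_le_mul_of_nonneg_right hlip (by positivity)).trans (le_of_eq ?_))
  rw [mul_pow, mul_pow, ← pow_mul, ← pow_mul, ← pow_mul]
  ring

lemma transcendental (h : RapidApproximation α γ g s t C L ρ) : Transcendental ℚ γ := by
  intro halg
  obtain ⟨P, hP0, hPγ⟩ := (IsFractionRing.isAlgebraic_iff ℤ ℚ ℂ).2 halg
  obtain ⟨Λ, hΛ, C₁, hC₁, hsep⟩ := h.exists_separation P.natDegree
    (R := ‖γ‖ + 1) (by linarith [norm_nonneg γ])
  set E := Λ * P.supNorm ^ ((minpoly ℚ α).natDegree + 1)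
  have hE : 0 ≤ E := mul_nonneg hΛ (pow_nonneg P.supNorm_nonneg _)
  have hlim := tendsto_mul_pow_mul_pow_zero h.tendsto_s h.tendsto_div h.ρ_pos.le h.ρ_lt_one
    (L * E) C₁ (zero_le_one.trans hC₁)
  refine h.not_eventually_eq (eventually_eq_of_tendsto_of_mem_finite h.tendsto
    (P.rootSet_finite ℂ) ?_)
  filter_upwards [hlim.eventually_lt_const zero_lt_one, h.eventually_norm_le,
    eventually_ge_atTop 1] with n hn hβ hn1
  rw [mem_rootSet]
  refine ⟨hP0, ?_⟩
  by_contra hne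
  have h1 := hsep n P γ hP0 le_rfl hPγ (by linarith) hβ hne
  rw [norm_sub_rev] at h1
  have h2 := mul_le_mul_of_nonneg_right (h.error_le n hn1)
    (by positivity : 0 ≤ E * C₁ ^ (s n + 1))
  refine absurd (h1.trans h2) (not_le.2 (lt_of_eq_of_lt ?_ hn))
  ring

/-- A transcendental limit is not an integer, so the `g n (α)` are eventually not integers. -/
lemma eventually_natDegree_eq (h : RapidApproximation α γ g s t C L ρ)
    (hsimple : IsSimpleAlgebraic α) :
    ∀ᶠ n in atTop, (minpoly ℚ (aeval α (g n))).natDegree = (minpoly ℚ α).natDegree := by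
  have hγ : γ ∈ (Set.range ((↑) : ℤ → ℂ))ᶜ := by
    rintro ⟨b, rfl⟩
    exact h.transcendental (isAlgebraic_intCast b)
  filter_upwards [h.tendsto (Complex.isClosed_range_intCast.isOpen_compl.mem_nhds hγ)] with n hn
  refine (exists_intCast_eq_or_natDegree_eq h.isIntegral hsimple (g n)).resolve_left ?_
  rintro ⟨b, hb⟩
  exact hn ⟨b, hb.symm⟩

lemma infinite_goodApproximations (h : RapidApproximation α γ g s t C L ρ)
    (hsimple : IsSimpleAlgebraic α) (w : ℝ) :
    (goodApproximations γ (minpoly ℚ α).natDegree w).Infinite := by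
  intro hfin
  refine h.not_eventually_eq (eventually_eq_of_tendsto_of_mem_finite h.tendsto hfin ?_)
  set m := (minpoly ℚ α).natDegree with hm
  obtain ⟨W, hW⟩ := exists_nat_ge w
  have hC0 : 0 ≤ C := zero_le_one.trans h.one_le_C
  have hlim := tendsto_mul_pow_mul_pow_zero h.tendsto_s h.tendsto_div h.ρ_pos.le h.ρ_lt_one
    (L * 2 ^ (m * W)) (C ^ (m * W)) (by positivity)
  filter_upwards [hlim.eventually_lt_const zero_lt_one, h.eventually_natDegree_eq hsimple,
    eventually_ge_atTop 1] with n hn hdeg hn1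
  have hint := isIntegral_aeval_int h.isIntegral (g n)
  refine ⟨(hint.tower_top (A := ℚ)).isAlgebraic, hdeg, _, isIntMinpoly_minpoly hint,
    (h.error_le n hn1).trans_lt ?_⟩
  set H := (minpoly ℤ (aeval α (g n))).supNorm
  have hH1 : 1 ≤ H := one_le_supNorm_of_ne_zero (minpoly.ne_zero hint)
  have hHle : H ≤ (2 * C ^ (s n + 1)) ^ m :=
    supNorm_minpoly_aeval_le h.isIntegral (one_le_pow₀ h.one_le_C) (h.conjugates_le n)
  have hpow : H ^ w ≤ ((2 * C ^ (s n + 1)) ^ m) ^ W :=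
    calc H ^ w ≤ H ^ (W : ℝ) := Real.rpow_le_rpow_of_exponent_le hH1 hW
      _ = H ^ W := Real.rpow_natCast _ _
      _ ≤ _ := pow_le_pow_left₀ (by positivity) hHle W
  rw [Real.rpow_neg (by positivity), ← one_div, lt_div_iff₀ (by positivity)]
  refine (mul_le_mul_of_nonneg_left hpow
    (mul_nonneg h.L_nonneg (pow_nonneg h.ρ_pos.le _))).trans_lt (lt_of_eq_of_lt ?_ hn)
  rw [← pow_mul, mul_pow, ← pow_mul, ← pow_mul, mul_comm (s n + 1)]
  ring

/-- Algebraic numbers of degree less than that of `α` approximate `γ` only to within a fixed power of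
their height. With `H` the height and `τ = √ρ`, compare the
root with `g n (α)` for the least `n` such that `H ^ (m + 1) * τ ^ t n ≤ 1`: half of the exponent
`t n` absorbs the height, the other half the conjugates of `g n (α)`; and since `s n ≤ B * t (n - 1)`
these conjugates are bounded by a power of `H`. -/
lemma exists_rpow_neg_le_norm_sub (h : RapidApproximation α γ g s t C L ρ)
    (hsimple : IsSimpleAlgebraic α) (hmono : Monotone t)
    {B : ℕ} (hB : ∀ n, 1 ≤ n → s (n + 1) ≤ B * t n) {k : ℕ} (hk : k < (minpoly ℚ α).natDegree) :
    ∃ w : ℝ, 0 < w ∧ ∃ H₀ : ℝ, ∀ (P : ℤ[X]) (ξ : ℂ), P ≠ 0 → P.natDegree ≤ k → aeval ξ P = 0 →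
      H₀ < P.supNorm → P.supNorm ^ (-w) ≤ ‖γ - ξ‖ := by
  obtain ⟨Λ, hΛ, C₁, hC₁, hsep⟩ := h.exists_separation k
    (R := ‖γ‖ + 1) (by linarith [norm_nonneg γ])
  set m := (minpoly ℚ α).natDegree with hm
  set τ := √ρ with hτ
  have hτ0 : 0 < τ := Real.sqrt_pos.2 h.ρ_pos
  have hτ1 : τ < 1 := by
    rw [hτ, Real.sqrt_lt' one_pos, one_pow]; exact h.ρ_lt_one
  have hττ : τ * τ = ρ := Real.mul_self_sqrt h.ρ_pos.le
  have hC₁0 : 0 < C₁ := zero_lt_one.trans_le hC₁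
  have hlim := tendsto_mul_pow_mul_pow_zero h.tendsto_s h.tendsto_div hτ0.le hτ1
    (L * Λ) C₁ hC₁0.le
  obtain ⟨n₀, hn₀⟩ := eventually_atTop.1
    (((hlim.eventually_le_const (by norm_num : (0 : ℝ) < 1 / 2)).and
      (h.eventually_norm_le.and (h.eventually_natDegree_eq hsimple))).and (eventually_ge_atTop 1))
  obtain ⟨J, hJ⟩ : ∃ J : ℕ, C₁ ^ B ≤ τ⁻¹ ^ J := by
    obtain ⟨J, hJ⟩ := pow_unbounded_of_one_lt (C₁ ^ B) ((one_lt_inv₀ hτ0).2 hτ1)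
    exact ⟨J, hJ.le⟩
  have hτt : Tendsto (fun n => τ ^ t n) atTop (nhds 0) := by
    simpa using tendsto_mul_pow_mul_pow_zero h.tendsto_s h.tendsto_div hτ0.le hτ1 1 1 zero_le_one
  -- The weight makes `H ^ (-w)` times all powers of `H` occurring below equal to `H⁻¹`. The bound
  -- on `H` makes the chosen `n` exceed `n₀` and `Λ * C₁ * H⁻¹` smaller than `1 / 2`.
  refine ⟨(m + 1) * (J + 1) + 1, by positivity, max (τ⁻¹ ^ t n₀) (2 * (Λ * C₁)), ?_⟩
  intro P ξ hP0 hPk hPξ hH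
  by_contra! hclose
  have hH1 : 1 ≤ P.supNorm := one_le_supNorm_of_ne_zero hP0
  set H := P.supNorm
  have hHpos : 0 < H := zero_lt_one.trans_le hH1
  set q := H ^ (m + 1) with hq
  have hq0 : 0 < q := by positivity
  have hex : ∃ n, q * τ ^ t n ≤ 1 := by
    have := hτt.const_mul q
    rw [mul_zero] at this
    exact (this.eventually_le_const zero_lt_one).exists
  classical
  obtain ⟨n, hn, hmin⟩ : ∃ n, q * τ ^ t n ≤ 1 ∧ ∀ j < n, 1 < q * τ ^ t j :=
    ⟨Nat.find hex, Nat.find_spec hex, fun j hj => not_le.1 (Nat.find_min hex hj)⟩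
  have hn₀n : n₀ < n := by
    by_contra! hle
    have h1 : τ ^ t n₀ ≤ τ ^ t n := pow_le_pow_of_le_one hτ0.le hτ1.le (hmono hle)
    have h2 : H ≤ q := le_self_pow₀ hH1 (Nat.succ_ne_zero m)
    have h3 : τ⁻¹ ^ t n₀ < q := ((le_max_left _ _).trans_lt hH).trans_le h2
    rw [inv_pow, inv_lt_iff_one_lt_mul₀ (by positivity), mul_comm] at h3
    have h4 := mul_le_mul_of_nonneg_left h1 hq0.le
    linarith
  obtain ⟨p, rfl⟩ : ∃ p, n = p + 1 := ⟨n - 1, by omega⟩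
  have hp : n₀ ≤ p := by omega
  obtain ⟨⟨hsmall, hβR, hdeg⟩, hn1⟩ := hn₀ (p + 1) (by omega)
  -- The conjugates of the chosen approximation are at most a power of the height of `ξ`.
  have hsn : C₁ ^ s (p + 1) ≤ q ^ J := by
    have hτp : τ⁻¹ ^ t p ≤ q := by
      rw [inv_pow, inv_le_iff_one_le_mul₀ (by positivity)]
      exact (hmin p (Nat.lt_succ_self p)).le
    calc C₁ ^ s (p + 1) ≤ C₁ ^ (B * t p) := pow_le_pow_right₀ hC₁ (hB p ((hn₀ p hp).2))
      _ = (C₁ ^ B) ^ t p := pow_mul _ _ _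
      _ ≤ (τ⁻¹ ^ J) ^ t p := by gcongr
      _ = (τ⁻¹ ^ t p) ^ J := by rw [← pow_mul, ← pow_mul, mul_comm]
      _ ≤ q ^ J := by gcongr
  have hHw : q ^ (J + 1) * H ^ (-(((m : ℝ) + 1) * (J + 1) + 1)) = H⁻¹ := by
    have : (((m : ℝ) + 1) * (J + 1) + 1) = (((m + 1) * (J + 1) + 1 : ℕ) : ℝ) := by push_cast; ring
    rw [this, Real.rpow_neg hHpos.le, Real.rpow_natCast, hq, ← pow_mul, pow_succ]
    field_simp
  have hξ1 : ‖γ - ξ‖ ≤ 1 := by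
    refine hclose.le.trans (Real.rpow_le_one_of_one_le_of_nonpos hH1 ?_)
    rw [neg_nonpos]; positivity
  have hξR : ‖ξ‖ ≤ ‖γ‖ + 1 := by
    have := norm_sub_norm_le ξ γ
    rw [norm_sub_rev] at this
    linarith
  have hne : aeval (aeval α (g (p + 1))) P ≠ 0 := by
    intro h0
    have hP' : P.map (algebraMap ℤ ℚ) ≠ 0 := by
      rw [algebraMap_int_eq]
      exact (Polynomial.map_ne_zero_iff Int.cast_injective).2 hP0
    have := natDegree_le_of_dvd (minpoly.dvd ℚ (aeval α (g (p + 1)))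
      (p := P.map (algebraMap ℤ ℚ)) (by rwa [aeval_map_algebraMap])) hP'
    have h2 := natDegree_map_le (p := P) (f := algebraMap ℤ ℚ)
    omega
  have key := hsep (p + 1) P ξ hP0 hPk hPξ hξR hβR hne
  have htri : ‖aeval α (g (p + 1)) - ξ‖ ≤
      H ^ (-(((m : ℝ) + 1) * (J + 1) + 1)) + L * ρ ^ t (p + 1) := by
    have h1 := norm_sub_le_norm_sub_add_norm_sub (aeval α (g (p + 1))) γ ξ
    have h2 := h.error_le (p + 1) hn1
    rw [norm_sub_rev] at h2
    linarith
  have hfirst : H ^ (-(((m : ℝ) + 1) * (J + 1) + 1)) * (Λ * q * C₁ ^ (s (p + 1) + 1))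
      ≤ Λ * C₁ * H⁻¹ := by
    rw [← hHw]
    calc _ = (H ^ (-(((m : ℝ) + 1) * (J + 1) + 1)) * Λ * q * C₁) * C₁ ^ s (p + 1) := by ring
      _ ≤ (H ^ (-(((m : ℝ) + 1) * (J + 1) + 1)) * Λ * q * C₁) * q ^ J := by gcongr
      _ = _ := by ring
  have hsecond : L * ρ ^ t (p + 1) * (Λ * q * C₁ ^ (s (p + 1) + 1)) ≤ 1 / 2 := by
    calc _ = (L * Λ * (C₁ ^ (s (p + 1) + 1) * τ ^ t (p + 1))) * (q * τ ^ t (p + 1)) := by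
          rw [← hττ, mul_pow]; ring
      _ ≤ (1 / 2) * 1 := by gcongr
      _ = 1 / 2 := mul_one _
  have hlt : Λ * C₁ * H⁻¹ < 1 / 2 := by
    rw [← div_eq_mul_inv, div_lt_iff₀ hHpos]
    linarith [(le_max_right (τ⁻¹ ^ t n₀) (2 * (Λ * C₁))).trans_lt hH]
  have hfinal := key.trans (mul_le_mul_of_nonneg_right htri (by positivity))
  rw [add_mul] at hfinal
  linarith

lemma mem_UNumbers (h : RapidApproximation α γ g s t C L ρ) (hsimple : IsSimpleAlgebraic α)
    (hmono : Monotone t) {B : ℕ} (hB : ∀ n, 1 ≤ n → s (n + 1) ≤ B * t n) :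
    γ ∈ UNumbers (minpoly ℚ α).natDegree := by
  refine ⟨h.transcendental, ⟨minpoly.natDegree_pos h.isIntegral.tower_top,
    fun w _ => h.infinite_goodApproximations hsimple w⟩, ?_⟩
  rintro k ⟨-, hk⟩
  by_contra! hlt
  obtain ⟨w, hw, H₀, hH₀⟩ := h.exists_rpow_neg_le_norm_sub hsimple hmono hB hlt
  refine hk w hw ((finite_roots_of_bounded_supNorm k H₀).subset ?_)
  rintro ξ ⟨-, hdeg, M, hM, hlt⟩
  have hMk : M.natDegree ≤ k := by rw [hM.natDegree_eq, hdeg]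
  refine ⟨M, hM.ne_zero, hMk, ?_, hM.2⟩
  by_contra! hbig
  exact absurd (hH₀ M ξ hM.ne_zero hMk hM.2 hbig) (not_le.2 hlt)

end RapidApproximation

/-! ### Truncations of a power series of bounded type -/

lemma norm_lt_one_of_lt_convergenceRadius {f : PowerSeries ℤ}
    (hinf : {k : ℕ | PowerSeries.coeff k f ≠ 0}.Infinite) {α : ℂ}
    (hα : ENNReal.ofReal ‖α‖ < convergenceRadius f) : ‖α‖ < 1 := by
  by_contra! h1
  have hsum := (FormalMultilinearSeries.ofScalars ℂ
    (fun k => ((PowerSeries.coeff k f : ℤ) : ℂ))).summable_norm_mul_pow (r := ‖α‖.toNNReal) hα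
  have hlim := hsum.tendsto_atTop_zero
  obtain ⟨N, hN⟩ := eventually_atTop.1 (hlim.eventually_lt_const (zero_lt_one))
  obtain ⟨k, hk, hNk⟩ := hinf.exists_gt N
  have := hN k hNk.le
  rw [FormalMultilinearSeries.ofScalars_norm, Complex.norm_intCast,
    Real.coe_toNNReal _ (norm_nonneg α)] at this
  have h2 : (1 : ℝ) ≤ |((PowerSeries.coeff k f : ℤ) : ℝ)| := by
    exact_mod_cast Int.one_le_abs hk
  exact absurd this (not_lt.2 (one_le_mul_of_one_le_of_one_le h2 (one_le_pow₀ h1)))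

lemma norm_seriesValue_sub_aeval_trunc_le {f : PowerSeries ℤ} {A : ℝ}
    (hA : ∀ k, |((PowerSeries.coeff k f : ℤ) : ℝ)| ≤ A) {α : ℂ} {ρ : ℝ} (hρ : ‖α‖ ≤ ρ)
    (hρ1 : ρ < 1) {s t : ℕ} (hst : s < t)
    (hgap : ∀ k, s < k → k < t → PowerSeries.coeff k f = 0) :
    ‖seriesValue f α - aeval α (PowerSeries.trunc (s + 1) f)‖ ≤ A * (1 - ρ)⁻¹ * ρ ^ t := by
  have hA0 : 0 ≤ A := (abs_nonneg _).trans (hA 0)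
  have hρ0 : 0 ≤ ρ := (norm_nonneg _).trans hρ
  have hbd : ∀ k, ‖((PowerSeries.coeff k f : ℤ) : ℂ) * α ^ k‖ ≤ A * ρ ^ k := fun k => by
    rw [norm_mul, norm_pow, Complex.norm_intCast]
    exact mul_le_mul (hA k) (pow_le_pow_left₀ (norm_nonneg _) hρ k) (by positivity) hA0
  have hgeom := hasSum_geometric_of_lt_one hρ0 hρ1
  have hsum : Summable fun k => ((PowerSeries.coeff k f : ℤ) : ℂ) * α ^ k :=
    Summable.of_norm_bounded (hgeom.summable.mul_left A) hbd
  have htr : aeval α (PowerSeries.trunc (s + 1) f)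
      = ∑ k ∈ Finset.range t, ((PowerSeries.coeff k f : ℤ) : ℂ) * α ^ k := by
    rw [aeval_eq_sum_range' (Nat.lt_of_lt_of_le (PowerSeries.natDegree_trunc_lt f s)
      (Nat.succ_le_of_lt hst))]
    refine Finset.sum_congr rfl fun k hk => ?_
    rw [PowerSeries.coeff_trunc, zsmul_eq_mul]
    split_ifs with h
    · rfl
    · rw [hgap k (by omega) (Finset.mem_range.1 hk)]
  rw [seriesValue, htr, ← hsum.sum_add_tsum_nat_add t, add_sub_cancel_left]
  refine tsum_of_norm_bounded (g := fun k => A * ρ ^ t * ρ ^ k) ?_ fun k => ?_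
  · have := hgeom.mul_left (A * ρ ^ t)
    rwa [mul_right_comm] at this
  · refine (hbd (k + t)).trans (le_of_eq ?_)
    ring

lemma abs_coeff_trunc_le {f : PowerSeries ℤ} {A : ℝ}
    (hA : ∀ k, |((PowerSeries.coeff k f : ℤ) : ℝ)| ≤ A) (n k : ℕ) :
    |((PowerSeries.trunc n f).coeff k : ℝ)| ≤ A := by
  rw [PowerSeries.coeff_trunc]
  split_ifs
  · exact hA k
  · simpa using (abs_nonneg _).trans (hA 0)

lemma norm_aeval_trunc_le {f : PowerSeries ℤ} {A : ℝ} (hA1 : 1 ≤ A)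
    (hA : ∀ k, |((PowerSeries.coeff k f : ℤ) : ℝ)| ≤ A) {z : ℂ} {R : ℝ} (hR : 1 ≤ R)
    (hz : ‖z‖ ≤ R) (n : ℕ) :
    ‖aeval z (PowerSeries.trunc (n + 1) f)‖ ≤ (2 * A * R) ^ (n + 1) := by
  refine (norm_aeval_le (Nat.lt_succ_iff.1 (PowerSeries.natDegree_trunc_lt f n)) (H := A)
    (fun k => ?_) hR hz).trans ?_
  · rw [Int.norm_eq_abs]; exact abs_coeff_trunc_le hA _ _
  · rw [mul_pow, mul_pow]
    gcongr
    · exact_mod_cast (Nat.lt_two_pow_self (n := n + 1)).le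
    · exact le_self_pow₀ hA1 n.succ_ne_zero
    · exact n.le_succ

/-- If the truncations `g n` of `f` take at `α` an eventually constant value, then some nonzero
`g (n + 1) - g n` vanishes at `α`, hence at all conjugates of `α`; its coefficients being bounded,
so are these conjugates. -/
lemma conjugates_le_of_eventually_eq {f : PowerSeries ℤ} {A : ℝ}
    (hA : ∀ k, |((PowerSeries.coeff k f : ℤ) : ℝ)| ≤ A)
    (hinf : {k : ℕ | PowerSeries.coeff k f ≠ 0}.Infinite) {s : ℕ → ℕ}
    (hs : Tendsto s atTop atTop) (hmono : ∀ n, 1 ≤ n → s n ≤ s (n + 1)) {α γ : ℂ}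
    (h : ∀ᶠ n in atTop, aeval α (PowerSeries.trunc (s n + 1) f) = γ) :
    ∀ z ∈ (minpoly ℚ α).rootSet ℂ, ‖z‖ ≤ A + 1 := by
  intro z hz
  by_contra! hlt
  obtain ⟨N₀, hN₀⟩ := eventually_atTop.1 h
  set N := max N₀ 1
  have hstep : ∀ n, N ≤ n →
      PowerSeries.trunc (s (n + 1) + 1) f = PowerSeries.trunc (s n + 1) f := by
    intro n hn
    by_contra hne
    have hn0 : N₀ ≤ n := (le_max_left _ _).trans hn
    have hn1 : 1 ≤ n := (le_max_right _ _).trans hn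
    set Q := PowerSeries.trunc (s (n + 1) + 1) f - PowerSeries.trunc (s n + 1) f with hQ
    have hα : aeval α Q = 0 := by
      rw [hQ, map_sub, hN₀ n hn0, hN₀ (n + 1) (by omega), sub_self]
    have hzQ : aeval z Q = 0 := by
      have hdvd : minpoly ℚ α ∣ Q.map (algebraMap ℤ ℚ) :=
        minpoly.dvd ℚ α (by rwa [aeval_map_algebraMap])
      obtain ⟨W, hW⟩ := hdvd
      rw [← aeval_map_algebraMap ℚ, hW, map_mul, (mem_rootSet.1 hz).2, zero_mul]
    refine absurd (norm_root_le_of_coeff_le (sub_ne_zero.2 hne) (fun k => ?_) hzQ) (not_le.2 hlt)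
    have hmn := hmono n hn1
    rw [coeff_sub, PowerSeries.coeff_trunc, PowerSeries.coeff_trunc]
    split_ifs
    · simpa using (abs_nonneg _).trans (hA 0)
    · simpa using hA k
    · omega
    · simpa using (abs_nonneg _).trans (hA 0)
  have hconst : ∀ n, N ≤ n → PowerSeries.trunc (s n + 1) f = PowerSeries.trunc (s N + 1) f := by
    intro n hn
    induction n, hn using Nat.le_induction with
    | base => rfl
    | succ n hn ih => rw [hstep n hn, ih]
  refine hinf ((Set.finite_Iic (s N)).subset fun k hk => ?_)
  by_contra hkN
  obtain ⟨n, hnk, hnN⟩ := ((hs.eventually_ge_atTop k).and (eventually_ge_atTop N)).exists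
  have := congrArg (fun P => P.coeff k) (hconst n hnN)
  simp only [PowerSeries.coeff_trunc] at this
  rw [if_pos (by omega), if_neg (by simpa using hkN)] at this
  exact hk this

/-! ### Values of generalized Liouville series -/

/-- Outside the finite set of `α` all of whose conjugates are at most `A + 1`, the values at `α` of
the truncations of `f` at its gaps approximate `f(α)` rapidly. -/
lemma rapidApproximation_trunc {f : PowerSeries ℤ} {A : ℝ} (hA1 : 1 ≤ A)
    (hA : ∀ k, |((PowerSeries.coeff k f : ℤ) : ℝ)| ≤ A)
    (hinf : {k : ℕ | PowerSeries.coeff k f ≠ 0}.Infinite) {s t : ℕ → ℕ}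
    (hts : ∀ n, t n ≤ s (n + 1)) (hst : ∀ n, s (n + 1) < t (n + 1))
    (hgap : ∀ n, 1 ≤ n → ∀ k, s n < k → k < t n → PowerSeries.coeff k f = 0)
    (hdiv : Tendsto (fun n => (t n : ℝ) / (s n : ℝ)) atTop atTop) {α : ℂ}
    (hα : IsIntegral ℤ α) (hα1 : ‖α‖ < 1)
    (hbig : ¬ ∀ z ∈ (minpoly ℚ α).rootSet ℂ, ‖z‖ ≤ A + 1) :
    ∃ C L ρ : ℝ, RapidApproximation α (seriesValue f α)
      (fun n => PowerSeries.trunc (s n + 1) f) s t C L ρ := by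
  obtain ⟨R₀, hR₀⟩ : ∃ R₀, ∀ z ∈ (minpoly ℚ α).rootSet ℂ, ‖z‖ ≤ R₀ :=
    ((minpoly ℚ α).rootSet_finite ℂ).isBounded.exists_norm_le
  have hR1 : 1 ≤ max R₀ 1 := le_max_right _ _
  have hmono : StrictMono t := strictMono_nat_of_lt_succ fun n => (hts n).trans_lt (hst n)
  have hs : Tendsto s atTop atTop :=
    (tendsto_add_atTop_iff_nat 1).1 (tendsto_atTop_mono hts hmono.tendsto_atTop)
  -- The maximum with `1 / 2` keeps `ρ` positive when `α = 0`.
  have hρ1 : max ‖α‖ (1 / 2) < 1 := max_lt hα1 (by norm_num)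
  refine ⟨2 * A * max R₀ 1, A * (1 - max ‖α‖ (1 / 2))⁻¹, max ‖α‖ (1 / 2), hα, hs, hdiv, ?_, ?_,
    lt_max_of_lt_right (by norm_num), hρ1, ?_, ?_, ?_⟩
  · exact one_le_mul_of_one_le_of_one_le (by linarith) hR1
  · exact mul_nonneg (by linarith) (inv_nonneg.2 (by linarith))
  · intro n z hz
    exact norm_aeval_trunc_le hA1 hA hR1 ((hR₀ z hz).trans (le_max_left _ _)) (s n)
  · intro n hn
    obtain ⟨p, rfl⟩ : ∃ p, n = p + 1 := ⟨n - 1, by omega⟩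
    exact norm_seriesValue_sub_aeval_trunc_le hA (le_max_left _ _) hρ1 (hst p) (hgap (p + 1) hn)
  · intro h
    refine hbig (conjugates_le_of_eventually_eq hA hinf hs (fun n hn => ?_) h)
    obtain ⟨p, rfl⟩ : ∃ p, n = p + 1 := ⟨n - 1, by omega⟩
    exact ((hst p).trans_le (hts (p + 1))).le

theorem mainTheorem3 (f : PowerSeries ℤ) (hf : IsGeneralizedLiouville f) (hb : IsBoundedType f)
    (m : ℕ) (hm : 0 < m) :
    {α : ℂ | IsSimpleAlgebraic α ∧ IsIntegral ℤ α ∧ (minpoly ℚ α).natDegree = m ∧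
      ENNReal.ofReal ‖α‖ < convergenceRadius f ∧ seriesValue f α ∉ UNumbers m}.Finite := by
  obtain ⟨-, hinf, s, t, hts, hst, -, hgap, hdiv, B, hB⟩ := hf
  obtain ⟨A, -, hA⟩ := hb
  have hA' : ∀ k, |((PowerSeries.coeff k f : ℤ) : ℝ)| ≤ max A 1 :=
    fun k => (hA k).trans (le_max_left _ _)
  refine (finite_isIntegral_of_bounded_conjugates m (max A 1 + 1)).subset ?_
  rintro α ⟨hsimple, hα, hdeg, hrad, hU⟩
  refine ⟨hα, hdeg, ?_⟩
  by_contra hbig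
  obtain ⟨C, L, ρ, h⟩ := rapidApproximation_trunc (le_max_right A 1) hA' hinf hts hst hgap hdiv hα
    (norm_lt_one_of_lt_convergenceRadius hinf hrad) hbig
  have hmono : StrictMono t := strictMono_nat_of_lt_succ fun n => (hts n).trans_lt (hst n)
  refine hU (hdeg ▸ h.mem_UNumbers hsimple hmono.monotone (B := ⌈B⌉₊) fun n hn => ?_)
  have htn : (0 : ℝ) < t n := by exact_mod_cast (Nat.zero_le _).trans_lt (hmono hn)
  have := (div_le_iff₀ htn).1 ((hB n hn).trans (Nat.le_ceil B))
  exact_mod_cast this
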